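/- Let $G=(V,E)$ be a finite simple undirected graph with node set $V=\{0,\dots,n-1\}$. For distinct $s,t\in V$ let $\kappa(s,t)$ denote the maximum number of pairwise internally disjoint $st$-paths in $G$. An $st$-cut is a set $C\subseteq (V\setminus\{s,t\})\cup E$ such that $G\setminus C$ has no $st$-path. Let $k\ge 1$ be an integer, and consider the following queries for distinct $s,t\in V$: - connectivity query: determine whether $\kappa(s,t)\ge k+1$; - cut query: if $\kappa(s,t)\le k$, return a pointer to an $st$-cut of size at most $k$. Theorem. For every such $G$ and $k$ there exists a data structure that occupies $O(k^2n+n^2)$ space, includes an explicitly stored list of $O(kn)$ cuts, each of size at most $k$, and answers each connectivity query and each cut query (by a pointer to a member of this list) in $O(1)$ time. Here space is counted in words of $O(\log n)$ bits (of at least one bit if $n\le 1$) and time in steps of a word RAM with this word size; the query programs and the constants in all $O(\cdot)$ bounds do not depend on $G$, $n$ or $k$. -/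

import Mathlib

/-! ### Local node connectivity and mixed cuts -/

namespace NodeConn

variable {V : Type*}

/-- The `st`-paths in `P` are pairwise internally disjoint: two distinct members share no node
other than `s` and `t`. -/
def InternallyDisjoint {G : SimpleGraph V} {s t : V} (P : Finset (G.Path s t)) : Prop :=
  ∀ p ∈ P, ∀ q ∈ P, p ≠ q →
    ∀ v : V, v ∈ (p : G.Walk s t).support → v ∈ (q : G.Walk s t).support → v = s ∨ v = t

/-- `κ(s,t)`: the maximum number of pairwise internally disjoint `st`-paths, as a supremum in `ℕ∞`
(it is a maximum, and finite, in a finite graph; it is only used for `s ≠ t`). -/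
noncomputable def kappa (G : SimpleGraph V) (s t : V) : ℕ∞ :=
  ⨆ (P : Finset (G.Path s t)) (_ : InternallyDisjoint P), (P.card : ℕ∞)

/-- `G ∖ C` for a set `C` of nodes and edges. Deleted nodes are kept as isolated nodes. -/
def deleteCut (G : SimpleGraph V) (C : Finset (V ⊕ Sym2 V)) : SimpleGraph V where
  Adj u v := G.Adj u v ∧ Sum.inl u ∉ C ∧ Sum.inl v ∉ C ∧ Sum.inr s(u, v) ∉ C
  symm := ⟨fun u v h => ⟨h.1.symm, h.2.2.1, h.2.1, by rw [Sym2.eq_swap]; exact h.2.2.2⟩⟩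
  loopless := ⟨fun _ h => G.irrefl h.1⟩

/-- `C` is an `st`-cut of `G`: it consists of nodes other than `s`, `t` and of edges of `G`, and
there is no `st`-path in `G ∖ C`. -/
def IsCut (G : SimpleGraph V) (s t : V) (C : Finset (V ⊕ Sym2 V)) : Prop :=
  Sum.inl s ∉ C ∧ Sum.inl t ∉ C ∧ (∀ e : Sym2 V, Sum.inr e ∈ C → e ∈ G.edgeSet) ∧
    ¬ (deleteCut G C).Reachable s t

end NodeConn

/-! ### A word RAM that queries a static memory -/

namespace WordRAM

/-- Instructions. Arguments are (fixed) register numbers, except for the immediate value `c` of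
`const` and the jump target `l` of `jumpLt`. The memory holding the data structure is read-only. -/
inductive Instr where
  /-- `r[d] := c` -/
  | const (d c : ℕ)
  /-- `r[d] := r[a] + r[b]` -/
  | add (d a b : ℕ)
  /-- `r[d] := r[a] - r[b]` (truncated at `0`) -/
  | sub (d a b : ℕ)
  /-- `r[d] := r[a] * r[b]` -/
  | mul (d a b : ℕ)
  /-- `r[d] := mem[r[a]]` -/
  | load (d a : ℕ)
  /-- if `r[a] < r[b]` then continue at instruction number `l` -/
  | jumpLt (a b l : ℕ)
  | halt

/-- A program is a fixed finite list of instructions, so it names only finitely many registers. -/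
abbrev Program := List Instr

structure State where
  pc : ℕ
  reg : ℕ → ℕ

/-- Write the word `x` (reduced modulo `2 ^ w`) to register `d` and go to the next instruction. -/
def State.write (w : ℕ) (σ : State) (d x : ℕ) : State :=
  ⟨σ.pc + 1, Function.update σ.reg d (x % 2 ^ w)⟩

/-- One step with word size `w` (in bits); `none` means that the machine has halted.
Memory cells outside the data structure read as `0`. -/
def step (P : Program) (w : ℕ) (mem : List ℕ) (σ : State) : Option State :=
  match P[σ.pc]? with
  | none => none
  | some .halt => none
  | some (.const d c) => some (σ.write w d c)
  | some (.add d a b) => some (σ.write w d (σ.reg a + σ.reg b))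
  | some (.sub d a b) => some (σ.write w d (σ.reg a - σ.reg b))
  | some (.mul d a b) => some (σ.write w d (σ.reg a * σ.reg b))
  | some (.load d a) => some (σ.write w d (mem.getD (σ.reg a) 0))
  | some (.jumpLt a b l) => some ⟨if σ.reg a < σ.reg b then l else σ.pc + 1, σ.reg⟩

/-- The state after `T` steps; a halted machine stays as it is. -/
def run (P : Program) (w : ℕ) (mem : List ℕ) (T : ℕ) (σ : State) : State :=
  (fun σ => (step P w mem σ).getD σ)^[T] σ

/-- Initial state on the input `(s, t)`: they are in registers `0` and `1`, all others are `0`. -/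
def init (s t : ℕ) : State :=
  ⟨0, fun i => if i = 0 then s else if i = 1 then t else 0⟩

/-- On the input `(s, t)`, the program halts after at most `T` steps with the answer `out`, which is
read off register `0`. -/
def Answers (P : Program) (w : ℕ) (mem : List ℕ) (T s t out : ℕ) : Prop :=
  step P w mem (run P w mem T (init s t)) = none ∧ (run P w mem T (init s t)).reg 0 = out

end WordRAM

/-! ### Data structures for connectivity and cut queries -/

namespace NodeConn

/-- A node `v` is stored as the two words `v, v`, an edge `uv` as the two words `u, v`. -/
def decodeElem {n : ℕ} (e : Fin n × Fin n) : Fin n ⊕ Sym2 (Fin n) :=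
  if e.1 = e.2 then Sum.inl e.1 else Sum.inr s(e.1, e.2)

/-- The set `C` of nodes and edges is written out explicitly in the memory from address `p` on: first
its size, then its elements one after the other, without repetition, two words each. -/
def StoredAt {n : ℕ} (mem : List ℕ) (p : ℕ) (C : Finset (Fin n ⊕ Sym2 (Fin n))) : Prop :=
  ∃ es : List (Fin n × Fin n),
    (es.map decodeElem).Nodup ∧ (es.map decodeElem).toFinset = C ∧
    (es.length :: es.flatMap fun e => [(e.1 : ℕ), (e.2 : ℕ)]) <+: mem.drop p

/-- A data structure: the memory contents, and the list of cuts that it includes, given by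
the addresses at which these are stored. -/
structure CutData where
  mem : List ℕ
  cuts : List ℕ

/-- With word size `w`, `D` is a valid data structure for `G` and `k`: all its cells hold words, its
list consists of cuts of `G` of size at most `k`, and for all pairs of distinct nodes `s, t`
* `conP` decides in at most `T` steps whether `κ(s,t) ≥ k + 1` (answers: `1` yes, `0` no);
* `cutP` halts in at most `T` steps, and if `κ(s,t) ≤ k`, then its answer is a pointer to a member
  of the list that is an `st`-cut of size at most `k`. -/
structure CutData.Valid (D : CutData) (conP cutP : WordRAM.Program) (w T : ℕ)
    {n : ℕ} (G : SimpleGraph (Fin n)) (k : ℕ) : Prop where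
  words : ∀ x ∈ D.mem, x < 2 ^ w
  cuts_stored : ∀ p ∈ D.cuts, ∃ C : Finset (Fin n ⊕ Sym2 (Fin n)),
    StoredAt D.mem p C ∧ C.card ≤ k ∧ ∃ x y : Fin n, x ≠ y ∧ IsCut G x y C
  con_yes : ∀ s t : Fin n, s ≠ t → ((k + 1 : ℕ) : ℕ∞) ≤ kappa G s t →
    WordRAM.Answers conP w D.mem T s t 1
  con_no : ∀ s t : Fin n, s ≠ t → ¬ ((k + 1 : ℕ) : ℕ∞) ≤ kappa G s t →
    WordRAM.Answers conP w D.mem T s t 0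
  cut : ∀ s t : Fin n, s ≠ t → ∃ p : ℕ, WordRAM.Answers cutP w D.mem T s t p ∧
    (kappa G s t ≤ (k : ℕ∞) → p ∈ D.cuts ∧ ∃ C : Finset (Fin n ⊕ Sym2 (Fin n)),
      StoredAt D.mem p C ∧ C.card ≤ k ∧ IsCut G s t C)

end NodeConn

/-! ### Bisets as labellings

A biset `(A, A⁺)` with `A ⊆ A⁺` is encoded by the labelling with value `2` on `A`, `1` on the
boundary `A⁺ ∖ A`, and `0` outside `A⁺`. Containment, intersection and union of bisets are the
pointwise order and lattice operations. -/

namespace NodeConn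

section Labels

variable {V : Type*}

/-! By Menger's theorem, a pair with κ(s,t) ≤ k is separated by a biset whose mixed cut (boundary
nodes, and edges from inside to outside) has at most `k` elements. So it suffices to find O(kn) such
bisets that separate every separable pair. Their cuts are stored, and an n × n table holds for each
pair a pointer to a suitable cut, or 0.

The family arises by elimination (`exists_separating_family`): some terminal of `T` is separated by
3k + 2 bisets from all terminals separable from it; it is removed, and the argument repeats. To find
it (`exists_cheap_terminal`), take a nest `A` with the fewest terminals inside. If no sub-biset with
cut size at most `k` splits these terminals, no two of them are separable, and `A` alone serves any
of them, up to at most `k` boundary terminals. Otherwise let `A₁` be a splitting sub-biset of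
minimum cut size. If more than `k` terminals inside `A` were outside `A₁`, then uncrossing, by
submodularity and symmetry of the cut size, would make `A₁` a smaller nest (`IsNest.of_min`). So at
most `k` are. For one of them, `A` and `A₁` leave as exceptions only these terminals and the two
boundaries, which gives 2 + 3k bisets.

The word size must not depend on `k`. Since any two nodes have a mixed cut of size at most `n`, the
family is built for min(k, n). -/

/-- Exchange inside and outside. -/
def co (f : V → Fin 3) : V → Fin 3 := fun v => (f v).rev

theorem co_eq_two {f : V → Fin 3} {v : V} : co f v = 2 ↔ f v = 0 := by
  unfold co; generalize f v = a; revert a; decide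

theorem co_eq_zero {f : V → Fin 3} {v : V} : co f v = 0 ↔ f v = 2 := by
  unfold co; generalize f v = a; revert a; decide

theorem co_eq_one {f : V → Fin 3} {v : V} : co f v = 1 ↔ f v = 1 := by
  unfold co; generalize f v = a; revert a; decide

/-- `f` separates `s` and `t`, in one of the two orientations. -/
def Separates (f : V → Fin 3) (s t : V) : Prop := (f s = 2 ∧ f t = 0) ∨ (f t = 2 ∧ f s = 0)

theorem Separates.symm {f : V → Fin 3} {s t : V} (h : Separates f s t) : Separates f t s := Or.symm h

theorem label_cases (f : V → Fin 3) (v : V) : f v = 0 ∨ f v = 1 ∨ f v = 2 := by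
  generalize f v = a; revert a; decide

theorem not_separates_self (f : V → Fin 3) (v : V) : ¬ Separates f v v := by
  rintro (⟨h, h'⟩ | ⟨h, h'⟩) <;> rw [h] at h' <;> exact absurd h' (by decide)

theorem co_sup_co_le : ∀ a b : Fin 3, (a ⊔ b.rev).rev ≤ b := by
  decide

variable [Fintype V]

/-! ### Mixed cuts and submodularity of their size -/

open Classical in
/-- The elements of the mixed cut of a labelling: boundary nodes `(v, v)`, and edges `(u, v)` that
lead from inside to outside. -/
noncomputable def cutPairs (G : SimpleGraph V) (f : V → Fin 3) : Finset (V × V) :=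
  Finset.univ.filter fun e =>
    (e.1 = e.2 ∧ f e.1 = 1) ∨ (G.Adj e.1 e.2 ∧ f e.1 = 2 ∧ f e.2 = 0)

theorem mem_cutPairs {G : SimpleGraph V} {f : V → Fin 3} {e : V × V} :
    e ∈ cutPairs G f ↔
      (e.1 = e.2 ∧ f e.1 = 1) ∨ (G.Adj e.1 e.2 ∧ f e.1 = 2 ∧ f e.2 = 0) := by
  simp [cutPairs]

/-- The size of the mixed cut of a labelling. -/
noncomputable def cutSize (G : SimpleGraph V) (f : V → Fin 3) : ℕ := (cutPairs G f).card

theorem cutSize_co (G : SimpleGraph V) (f : V → Fin 3) : cutSize G (co f) = cutSize G f := by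
  refine Finset.card_bij (fun e _ => e.swap) ?_ ?_ ?_
  · rintro ⟨a, b⟩ h
    simp only [mem_cutPairs, co_eq_one, co_eq_two, co_eq_zero, Prod.swap] at h ⊢
    rcases h with ⟨rfl, h⟩ | ⟨h1, h2, h3⟩
    · exact Or.inl ⟨rfl, h⟩
    · exact Or.inr ⟨h1.symm, h3, h2⟩
  · intro a _ b _ h
    exact Prod.swap_injective h
  · rintro ⟨a, b⟩ h
    refine ⟨(b, a), ?_, rfl⟩
    simp only [mem_cutPairs, co_eq_one, co_eq_two, co_eq_zero] at h ⊢
    rcases h with ⟨rfl, h⟩ | ⟨h1, h2, h3⟩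
    · exact Or.inl ⟨rfl, h⟩
    · exact Or.inr ⟨h1.symm, h3, h2⟩

theorem edge_submodular : ∀ a b c d : Fin 3,
    ((if a ⊓ c = 2 ∧ b ⊓ d = 0 then 1 else 0) + (if a ⊔ c = 2 ∧ b ⊔ d = 0 then 1 else 0) : ℕ) ≤
      (if a = 2 ∧ b = 0 then 1 else 0) + (if c = 2 ∧ d = 0 then 1 else 0) := by
  decide

theorem node_modular : ∀ a c : Fin 3,
    ((if a ⊓ c = 1 then 1 else 0) + (if a ⊔ c = 1 then 1 else 0) : ℕ) =
      (if a = 1 then 1 else 0) + (if c = 1 then 1 else 0) := by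
  decide

/-- The inequality holds pair by pair. At a node it is an equality, because meet and join of two
labels in a chain are the two labels again; at an edge it is a finite check. -/
theorem cutSize_submodular (G : SimpleGraph V) (f g : V → Fin 3) :
    cutSize G (f ⊓ g) + cutSize G (f ⊔ g) ≤ cutSize G f + cutSize G g := by
  classical
  simp only [cutSize, cutPairs, Finset.card_filter, ← Finset.sum_add_distrib]
  refine Finset.sum_le_sum ?_
  rintro ⟨a, b⟩ -
  by_cases hab : a = b
  · subst hab
    simpa using (node_modular (f a) (g a)).le
  · by_cases h : G.Adj a b
    · simpa [hab, h] using edge_submodular (f a) (f b) (g a) (g b)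
    · simp [hab, h]

theorem card_boundary_le (G : SimpleGraph V) (f : V → Fin 3) (T : Finset V) :
    (T.filter fun v => f v = 1).card ≤ cutSize G f := by
  refine Finset.card_le_card_of_injOn (fun v => (v, v)) ?_ ?_
  · intro v hv
    have := (Finset.mem_filter.1 hv).2
    simp [mem_cutPairs, this]
  · intro a _ b _ h
    exact (Prod.mk.inj h).1

/-! ### Nests and uncrossing -/

/-- The biset `A` meets `T`, and separable pairs of `T` inside `A` are separated by bisets contained
in `A`. -/
structure IsNest (G : SimpleGraph V) (k : ℕ) (T : Finset V) (A : V → Fin 3) : Prop where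
  nonempty : ∃ v ∈ T, A v = 2
  size : cutSize G A ≤ k
  refine : ∀ s ∈ T, ∀ t ∈ T, A s = 2 → A t = 2 → (∃ f, cutSize G f ≤ k ∧ Separates f s t) →
    ∃ B ≤ A, cutSize G B ≤ k ∧ Separates B s t

theorem isNest_top (G : SimpleGraph V) (k : ℕ) {T : Finset V} (hT : T.Nonempty) :
    IsNest G k T ⊤ where
  nonempty := let ⟨v, hv⟩ := hT; ⟨v, hv, rfl⟩
  size := by
    have : cutPairs G (⊤ : V → Fin 3) = ∅ := by
      ext e
      simp only [mem_cutPairs, Pi.top_apply, Finset.notMem_empty, iff_false]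
      rintro (⟨-, h⟩ | ⟨-, -, h⟩) <;> revert h <;> decide
    simp [cutSize, this]
  refine := fun _ _ _ _ _ _ ⟨f, h, h'⟩ => ⟨f, le_top, h, h'⟩

/-- Uncrossing: a biset of minimum cut size among those that split the terminals of a nest is again a
nest, if it leaves more than `k` terminals outside. -/
theorem IsNest.of_min {G : SimpleGraph V} {k : ℕ} {T : Finset V} {A A₁ : V → Fin 3}
    (hA : IsNest G k T A) (hle : A₁ ≤ A) (hk : cutSize G A₁ ≤ k) (hne : ∃ s ∈ T, A₁ s = 2)
    (hmin : ∀ B ≤ A, (∃ s ∈ T, B s = 2) → (∃ r ∈ T, A r = 2 ∧ B r = 0) →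
      cutSize G A₁ ≤ cutSize G B)
    (hout : k < (T.filter fun r => A r = 2 ∧ A₁ r = 0).card) : IsNest G k T A₁ := by
  have two_of_le : ∀ v, A₁ v = 2 → A v = 2 := by
    intro v hv
    have := hle v
    rw [hv] at this
    exact le_antisymm (Fin.le_last _) this
  have key : ∀ s ∈ T, ∀ t ∈ T, A₁ s = 2 → A₁ t = 2 → ∀ B ≤ A, cutSize G B ≤ k →
      B s = 2 → B t = 0 → ∃ C ≤ A₁, cutSize G C ≤ k ∧ Separates C s t := by
    intro s hs t ht hs1 ht1 B hBA hBk hBs hBt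
    -- At most `k` terminals lie on the boundary of `B`, too few to include all terminals inside `A`
    -- and outside `A₁`.
    obtain ⟨r, hr, hrB⟩ : ∃ r ∈ T.filter (fun r => A r = 2 ∧ A₁ r = 0), B r ≠ 1 := by
      by_contra! hcon
      have : (T.filter fun r => A r = 2 ∧ A₁ r = 0) ⊆ T.filter fun v => B v = 1 := by
        intro r hr
        exact Finset.mem_filter.2 ⟨(Finset.mem_filter.1 hr).1, hcon r hr⟩
      have := Finset.card_le_card this
      have := card_boundary_le G B T
      omega
    obtain ⟨hrT, hrA, hrA1⟩ := Finset.mem_filter.1 hr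
    have hcases : B r = 0 ∨ B r = 2 := by
      generalize B r = b at hrB
      revert b; decide
    rcases hcases with h0 | h2
    -- `A₁ ⊔ B` still splits the terminals of `A`, with `s` inside and `r` outside, so its cut is no
    -- smaller than that of `A₁`. By submodularity the cut of `A₁ ⊓ B` is no larger than that of
    -- `B`.
    · have h := cutSize_submodular G A₁ B
      have h' := hmin (A₁ ⊔ B) (sup_le hle hBA) ⟨s, hs, by simp [hs1, hBs]⟩
        ⟨r, hrT, hrA, by simp [hrA1, h0]⟩
      refine ⟨A₁ ⊓ B, inf_le_left, by omega, Or.inl ⟨by simp [hs1, hBs], by simp [hBt]⟩⟩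
    -- With `r` inside `B`, the splitting biset is the difference `co (A₁ ⊔ co B)`, which has `r`
    -- inside and `s` outside. By symmetry of the cut size, the same count bounds `A₁ ⊓ co B`, which
    -- has `t` inside and `s` outside.
    · have h := cutSize_submodular G A₁ (co B)
      have h' := hmin (co (A₁ ⊔ co B)) ?_ ⟨r, hrT, ?_⟩ ⟨s, hs, two_of_le s hs1, ?_⟩
      · rw [cutSize_co] at h'
        rw [cutSize_co] at h
        refine ⟨A₁ ⊓ co B, inf_le_left, by omega, Or.inr ⟨?_, ?_⟩⟩
        · simp [ht1, co_eq_two.2 hBt]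
        · simp [co_eq_zero.2 hBs]
      · refine le_trans ?_ hBA
        exact fun v => co_sup_co_le (A₁ v) (B v)
      · simp [co_eq_two, co_eq_zero.2 h2, hrA1]
      · rw [co_eq_zero]; simp [hs1, co_eq_zero.2 hBs]
  refine ⟨hne, hk, ?_⟩
  intro s hs t ht hs1 ht1 hsep
  obtain ⟨B, hBA, hBk, h | h⟩ := hA.refine s hs t ht (two_of_le s hs1) (two_of_le t ht1) hsep
  · exact key s hs t ht hs1 ht1 B hBA hBk h.1 h.2
  · obtain ⟨C, h1, h2, h3⟩ := key t ht s hs ht1 hs1 B hBA hBk h.1 h.2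
    exact ⟨C, h1, h2, h3.symm⟩

/-- Each exceptional terminal in `U` costs one further biset, chosen for it alone. -/
theorem exists_family_of_exceptions {G : SimpleGraph V} {k : ℕ} {T : Finset V} {v : V}
    (F₀ : Finset (V → Fin 3)) (hF₀ : ∀ f ∈ F₀, cutSize G f ≤ k) (U : Finset V)
    (hU : ∀ t ∈ T, (∃ f, cutSize G f ≤ k ∧ Separates f v t) →
      t ∈ U ∨ ∃ f ∈ F₀, Separates f v t) :
    ∃ F : Finset (V → Fin 3), F.card ≤ F₀.card + U.card ∧ (∀ f ∈ F, cutSize G f ≤ k) ∧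
      ∀ t ∈ T, (∃ f, cutSize G f ≤ k ∧ Separates f v t) → ∃ f ∈ F, Separates f v t := by
  classical
  have hex : ∀ t : V, ∃ f, (∃ f, cutSize G f ≤ k ∧ Separates f v t) →
      cutSize G f ≤ k ∧ Separates f v t := by
    intro t
    by_cases h : ∃ f, cutSize G f ≤ k ∧ Separates f v t
    · exact ⟨h.choose, fun _ => h.choose_spec⟩
    · exact ⟨⊤, fun h' => absurd h' h⟩
  choose c hc using hex
  refine ⟨F₀ ∪ (U.filter fun t => ∃ f, cutSize G f ≤ k ∧ Separates f v t).image c, ?_, ?_, ?_⟩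
  · refine (Finset.card_union_le _ _).trans (Nat.add_le_add_left ?_ _)
    exact Finset.card_image_le.trans (Finset.card_filter_le _ _)
  · intro f hf
    rcases Finset.mem_union.1 hf with hf | hf
    · exact hF₀ f hf
    · obtain ⟨t, ht, rfl⟩ := Finset.mem_image.1 hf
      exact (hc t (Finset.mem_filter.1 ht).2).1
  · intro t ht hsep
    rcases hU t ht hsep with h | ⟨f, hf, h⟩
    · exact ⟨c t, Finset.mem_union_right _
        (Finset.mem_image_of_mem _ (Finset.mem_filter.2 ⟨h, hsep⟩)), (hc t hsep).2⟩
    · exact ⟨f, Finset.mem_union_left _ hf, h⟩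

/-- In every nonempty terminal set some terminal is separated from all terminals separable from it by
`3k + 2` bisets. -/
theorem exists_cheap_terminal (G : SimpleGraph V) (k : ℕ) {T : Finset V} (hT : T.Nonempty) :
    ∃ v ∈ T, ∃ F : Finset (V → Fin 3), F.card ≤ 3 * k + 2 ∧ (∀ f ∈ F, cutSize G f ≤ k) ∧
      ∀ t ∈ T, (∃ f, cutSize G f ≤ k ∧ Separates f v t) → ∃ f ∈ F, Separates f v t := by
  classical
  obtain ⟨A, hA, hAmin⟩ := Finset.exists_min_image
    (Finset.univ.filter fun A : V → Fin 3 => IsNest G k T A)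
    (fun A => (T.filter fun v => A v = 2).card) ⟨⊤, by simpa using isNest_top G k hT⟩
  replace hA : IsNest G k T A := by simpa using hA
  have hAk := hA.size
  have hbA := card_boundary_le G A T
  by_cases hsplit : ∃ B ≤ A, cutSize G B ≤ k ∧ (∃ s ∈ T, B s = 2) ∧ ∃ r ∈ T, A r = 2 ∧ B r = 0
  · obtain ⟨A₁, hA₁, hmin⟩ := Finset.exists_min_image
      (Finset.univ.filter fun B : V → Fin 3 => B ≤ A ∧ cutSize G B ≤ k ∧ (∃ s ∈ T, B s = 2) ∧
        ∃ r ∈ T, A r = 2 ∧ B r = 0) (cutSize G)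
      (by obtain ⟨B, hB⟩ := hsplit; exact ⟨B, by simpa using hB⟩)
    obtain ⟨hle, hk, hne, r, hr, hrA, hrA1⟩ := (Finset.mem_filter.1 hA₁).2
    have hmin' : ∀ B ≤ A, (∃ s ∈ T, B s = 2) → (∃ r ∈ T, A r = 2 ∧ B r = 0) →
        cutSize G A₁ ≤ cutSize G B := by
      intro B h1 h2 h3
      -- `A₁` is minimal only among bisets of cut size at most `k`, but any other biset has a larger
      -- cut anyway.
      by_cases h : cutSize G B ≤ k
      · exact hmin B (Finset.mem_filter.2 ⟨Finset.mem_univ _, h1, h, h2, h3⟩)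
      · omega
    have hout : (T.filter fun r => A r = 2 ∧ A₁ r = 0).card ≤ k := by
      by_contra! hcon
      have hnest := hA.of_min hle hk hne hmin' hcon
      have h1 := hAmin A₁ (by simpa using hnest)
      have h2 : (T.filter fun v => A₁ v = 2).card < (T.filter fun v => A v = 2).card := by
        refine Finset.card_lt_card (Finset.ssubset_iff_of_subset ?_ |>.2 ⟨r, ?_, ?_⟩)
        · intro v hv
          obtain ⟨hv1, hv2⟩ := Finset.mem_filter.1 hv
          have := hle v
          rw [hv2] at this
          exact Finset.mem_filter.2 ⟨hv1, le_antisymm (Fin.le_last _) this⟩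
        · exact Finset.mem_filter.2 ⟨hr, hrA⟩
        · simp [hrA1]
      omega
    have hbA1 := card_boundary_le G A₁ T
    obtain ⟨F, h1, h2, h3⟩ := exists_family_of_exceptions (G := G) (k := k) (T := T) (v := r)
      {A, A₁} (by simp [hAk, hk])
      ((T.filter fun v => A v = 1) ∪ (T.filter fun v => A₁ v = 1) ∪
        T.filter fun r => A r = 2 ∧ A₁ r = 0) (by
        intro t ht _
        simp only [Finset.mem_union, Finset.mem_filter, Finset.mem_insert, Finset.mem_singleton,
          exists_eq_or_imp, exists_eq_left]
        rcases label_cases A t with h | h | h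
        · exact Or.inr (Or.inl (Or.inl ⟨hrA, h⟩))
        · exact Or.inl (Or.inl (Or.inl ⟨ht, h⟩))
        · rcases label_cases A₁ t with h' | h' | h'
          · exact Or.inl (Or.inr ⟨ht, h, h'⟩)
          · exact Or.inl (Or.inl (Or.inr ⟨ht, h'⟩))
          · exact Or.inr (Or.inr (Or.inr ⟨h', hrA1⟩)))
    refine ⟨r, hr, F, h1.trans ?_, h2, h3⟩
    have := Finset.card_le_two (a := A) (b := A₁)
    have := Finset.card_union_le ((T.filter fun v => A v = 1) ∪ (T.filter fun v => A₁ v = 1))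
      (T.filter fun r => A r = 2 ∧ A₁ r = 0)
    have := Finset.card_union_le (T.filter fun v => A v = 1) (T.filter fun v => A₁ v = 1)
    omega
  · obtain ⟨v, hv, hvA⟩ := hA.nonempty
    obtain ⟨F, h1, h2, h3⟩ := exists_family_of_exceptions (G := G) (k := k) (T := T) (v := v)
      {A} (by simp [hAk]) (T.filter fun v => A v = 1) (by
        intro t ht hsep
        simp only [Finset.mem_filter, Finset.mem_singleton, exists_eq_left]
        rcases label_cases A t with h | h | h
        · exact Or.inr (Or.inl ⟨hvA, h⟩)
        · exact Or.inl ⟨ht, h⟩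
        · obtain ⟨B, hB, hBk, hs | hs⟩ := hA.refine v hv t ht hvA h hsep
          · exact absurd ⟨B, hB, hBk, ⟨v, hv, hs.1⟩, t, ht, h, hs.2⟩ hsplit
          · exact absurd ⟨B, hB, hBk, ⟨t, ht, hs.1⟩, v, hv, hvA, hs.2⟩ hsplit)
    refine ⟨v, hv, F, h1.trans ?_, h2, h3⟩
    rw [Finset.card_singleton]
    omega

/-- All separable pairs of `T` are separated by `(3k + 2) |T|` bisets. -/
theorem exists_separating_family (G : SimpleGraph V) (k : ℕ) (T : Finset V) :
    ∃ F : Finset (V → Fin 3), F.card ≤ (3 * k + 2) * T.card ∧ (∀ f ∈ F, cutSize G f ≤ k) ∧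
      ∀ s ∈ T, ∀ t ∈ T, (∃ f, cutSize G f ≤ k ∧ Separates f s t) → ∃ f ∈ F, Separates f s t := by
  classical
  induction hm : T.card generalizing T with
  | zero =>
    obtain rfl := Finset.card_eq_zero.1 hm
    exact ⟨∅, by simp⟩
  | succ m ih =>
    obtain ⟨v, hv, F, h1, h2, h3⟩ := exists_cheap_terminal G k
      (Finset.card_pos.1 (by omega : 0 < T.card))
    obtain ⟨F', h1', h2', h3'⟩ := ih (T.erase v) (by rw [Finset.card_erase_of_mem hv]; omega)
    refine ⟨F ∪ F', ?_, ?_, ?_⟩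
    · have := Finset.card_union_le F F'
      rw [Nat.mul_succ]
      omega
    · intro f hf
      rcases Finset.mem_union.1 hf with h | h
      exacts [h2 f h, h2' f h]
    · intro s hs t ht hsep
      by_cases hsv : s = v
      · subst hsv
        obtain ⟨f, hf, h⟩ := h3 t ht hsep
        exact ⟨f, Finset.mem_union_left _ hf, h⟩
      · by_cases htv : t = v
        · subst htv
          obtain ⟨g, hg, hg'⟩ := hsep
          obtain ⟨f, hf, h⟩ := h3 s hs ⟨g, hg, hg'.symm⟩
          exact ⟨f, Finset.mem_union_left _ hf, h.symm⟩
        · obtain ⟨f, hf, h⟩ := h3' s (Finset.mem_erase.2 ⟨hsv, hs⟩) t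
            (Finset.mem_erase.2 ⟨htv, ht⟩) hsep
          exact ⟨f, Finset.mem_union_right _ hf, h⟩

end Labels

end NodeConn

/-! ### Menger's theorem for finite digraphs -/

namespace NodeConn

section Menger

variable {V : Type*}

/-- `l` lists the nodes of a walk from `A` to `B` along arcs of `E`. -/
structure IsRoute (E : Finset (V × V)) (A B : Finset V) (l : List V) : Prop where
  chain : l.IsChain fun u v => (u, v) ∈ E
  head : ∃ a ∈ A, l.head? = some a
  last : ∃ b ∈ B, l.getLast? = some b

/-- `X` meets every walk from `A` to `B`. -/
def IsSeparator (E : Finset (V × V)) (A B X : Finset V) : Prop :=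
  ∀ l, IsRoute E A B l → ∃ v ∈ l, v ∈ X

/-- The arc `(x, y)` is used only when leaving `x`, and here `x` can occur at most as the last node.
-/
theorem isChain_erase_of_tail_notMem [DecidableEq V] {E : Finset (V × V)} {x y : V} :
    ∀ (l : List V) (p : V), x ∉ l → (l ++ [p]).IsChain (fun u v => (u, v) ∈ E) →
      (l ++ [p]).IsChain fun u v => (u, v) ∈ E.erase (x, y)
  | [], p, _, _ => List.isChain_singleton _
  | [a], p, hx, h => by
    have hax : a ≠ x := fun h => hx (by simp [h])
    simpa [hax] using h
  | a :: b :: l, p, hx, h => by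
    simp only [List.cons_append, List.isChain_cons_cons] at h ⊢
    refine ⟨Finset.mem_erase.2 ⟨fun h' => hx ?_, h.1⟩, ?_⟩
    · simp [(Prod.mk.inj h').1]
    · exact isChain_erase_of_tail_notMem (b :: l) p (fun h' => hx (List.mem_cons_of_mem _ h')) h.2

theorem isChain_erase_of_head_notMem [DecidableEq V] {E : Finset (V × V)} {x y : V} :
    ∀ (l : List V) (p : V), y ∉ l → (p :: l).IsChain (fun u v => (u, v) ∈ E) →
      (p :: l).IsChain fun u v => (u, v) ∈ E.erase (x, y)
  | [], p, _, _ => List.isChain_singleton _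
  | a :: l, p, hy, h => by
    simp only [List.isChain_cons_cons] at h ⊢
    refine ⟨Finset.mem_erase.2 ⟨fun h' => hy ?_, h.1⟩, ?_⟩
    · simp [(Prod.mk.inj h').2]
    · exact isChain_erase_of_head_notMem l a (fun h' => hy (List.mem_cons_of_mem _ h')) h.2

theorem exists_first_of_mem {P : V → Prop} :
    ∀ l : List V, (∃ v ∈ l, P v) → ∃ l₁ p l₂, l = l₁ ++ p :: l₂ ∧ P p ∧ ∀ v ∈ l₁, ¬ P v
  | [], h => by simp at h
  | a :: l, h => by
    by_cases ha : P a
    · exact ⟨[], a, l, rfl, ha, by simp⟩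
    · obtain ⟨l₁, p, l₂, rfl, hp, h'⟩ := exists_first_of_mem l (by simpa [ha] using h)
      exact ⟨a :: l₁, p, l₂, rfl, hp, by simpa [ha] using h'⟩

theorem exists_last_of_mem {P : V → Prop} (l : List V) (h : ∃ v ∈ l, P v) :
    ∃ l₁ p l₂, l = l₁ ++ p :: l₂ ∧ P p ∧ ∀ v ∈ l₂, ¬ P v := by
  obtain ⟨l₁, p, l₂, h1, h2, h3⟩ := exists_first_of_mem l.reverse (by simpa using h)
  refine ⟨l₂.reverse, p, l₁.reverse, ?_, h2, by simpa using h3⟩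
  have := congrArg List.reverse h1
  simpa using this

theorem head?_append_cons (l m m' : List V) (v : V) :
    (l ++ v :: m).head? = (l ++ v :: m').head? := by
  simp [List.head?_append]

/-- Disjoint routes ending in a set of as many nodes can be indexed by their ends. -/
theorem exists_routes_by_last {k : ℕ} {E : Finset (V × V)} {A P : Finset V} (hP : P.card = k)
    (α : Fin k → List V) (hα : ∀ i, IsRoute E A P (α i) ∧ (α i).Nodup)
    (hdisj : ∀ i j, i ≠ j → (α i).Disjoint (α j)) :
    ∃ a : V → List V, (∀ p ∈ P, IsRoute E A P (a p ++ [p]) ∧ (a p ++ [p]).Nodup) ∧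
      ∀ p ∈ P, ∀ p' ∈ P, ∀ v ∈ a p ++ [p], v ∈ a p' ++ [p'] → p = p' := by
  choose e heP he using fun i => (hα i).1.last
  have hinj : Function.Injective e := by
    intro i j hij
    by_contra hne
    refine hdisj i j hne (List.mem_of_getLast? (he i)) ?_
    rw [hij]
    exact List.mem_of_getLast? (he j)
  have hsurj : ∀ p ∈ P, ∃ i, e i = p := by
    intro p hp
    have := Finset.surj_on_of_inj_on_of_card_le (s := Finset.univ) (t := P) (fun i _ => e i)
      (fun i _ => heP i) (fun i j _ _ h => hinj h) (by simp [hP]) p hp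
    obtain ⟨i, -, hi⟩ := this
    exact ⟨i, hi.symm⟩
  have hsplit : ∀ p, ∃ l : List V, p ∈ P → ∃ i, e i = p ∧ α i = l ++ [p] := by
    intro p
    by_cases hp : p ∈ P
    · obtain ⟨i, hi⟩ := hsurj p hp
      obtain ⟨l, hl⟩ := List.getLast?_eq_some_iff.1 (he i)
      exact ⟨l, fun _ => ⟨i, hi, by rw [hl, hi]⟩⟩
    · exact ⟨[], fun h => absurd h hp⟩
  choose a ha using hsplit
  refine ⟨a, ?_, ?_⟩
  · intro p hp
    obtain ⟨i, -, hi⟩ := ha p hp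
    exact hi ▸ hα i
  · intro p hp p' hp' v hv hv'
    obtain ⟨i, hei, hi⟩ := ha p hp
    obtain ⟨j, hej, hj⟩ := ha p' hp'
    by_contra hne
    refine hdisj i j ?_ (hi ▸ hv) (hj ▸ hv')
    rintro rfl
    exact hne (hei.symm.trans hej)

/-- Disjoint routes starting in a set of as many nodes can be indexed by their starts. -/
theorem exists_routes_by_head {k : ℕ} {E : Finset (V × V)} {Q B : Finset V} (hQ : Q.card = k)
    (β : Fin k → List V) (hβ : ∀ i, IsRoute E Q B (β i) ∧ (β i).Nodup)
    (hdisj : ∀ i j, i ≠ j → (β i).Disjoint (β j)) :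
    ∃ b : V → List V, (∀ q ∈ Q, IsRoute E Q B (q :: b q) ∧ (q :: b q).Nodup) ∧
      ∀ q ∈ Q, ∀ q' ∈ Q, ∀ v ∈ q :: b q, v ∈ q' :: b q' → q = q' := by
  choose e heQ he using fun i => (hβ i).1.head
  have hinj : Function.Injective e := by
    intro i j hij
    by_contra hne
    refine hdisj i j hne (List.mem_of_head? (he i)) ?_
    rw [hij]
    exact List.mem_of_head? (he j)
  have hsurj : ∀ q ∈ Q, ∃ i, e i = q := by
    intro q hq
    have := Finset.surj_on_of_inj_on_of_card_le (s := Finset.univ) (t := Q) (fun i _ => e i)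
      (fun i _ => heQ i) (fun i j _ _ h => hinj h) (by simp [hQ]) q hq
    obtain ⟨i, -, hi⟩ := this
    exact ⟨i, hi.symm⟩
  have hsplit : ∀ q, ∃ l : List V, q ∈ Q → ∃ i, e i = q ∧ β i = q :: l := by
    intro q
    by_cases hq : q ∈ Q
    · obtain ⟨i, hi⟩ := hsurj q hq
      obtain ⟨l, hl⟩ := List.head?_eq_some_iff.1 (he i)
      exact ⟨l, fun _ => ⟨i, hi, by rw [hl, hi]⟩⟩
    · exact ⟨[], fun h => absurd h hq⟩
  choose b hb using hsplit
  refine ⟨b, ?_, ?_⟩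
  · intro q hq
    obtain ⟨i, -, hi⟩ := hb q hq
    exact hi ▸ hβ i
  · intro q hq q' hq' v hv hv'
    obtain ⟨i, hei, hi⟩ := hb q hq
    obtain ⟨j, hej, hj⟩ := hb q' hq'
    by_contra hne
    refine hdisj i j ?_ (hi ▸ hv) (hj ▸ hv')
    rintro rfl
    exact hne (hei.symm.trans hej)

/-- Routes into `P` and routes out of `Q` meet only in a separator `S ⊆ P ∩ Q`, at their ends. -/
theorem routes_meet_in_separator {E : Finset (V × V)} {A B P Q S : Finset V}
    (hS : IsSeparator E A B S) (hSP : S ⊆ P) (hSQ : S ⊆ Q) {a b : V → List V}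
    (ha : ∀ p ∈ P, IsRoute E A P (a p ++ [p]) ∧ (a p ++ [p]).Nodup)
    (ha' : ∀ p ∈ P, ∀ p' ∈ P, ∀ v ∈ a p ++ [p], v ∈ a p' ++ [p'] → p = p')
    (hb : ∀ q ∈ Q, IsRoute E Q B (q :: b q) ∧ (q :: b q).Nodup)
    (hb' : ∀ q ∈ Q, ∀ q' ∈ Q, ∀ v ∈ q :: b q, v ∈ q' :: b q' → q = q')
    {p q v : V} (hp : p ∈ P) (hq : q ∈ Q) (hvp : v ∈ a p ++ [p]) (hvq : v ∈ q :: b q) :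
    v ∈ S ∧ v = p ∧ v = q := by
  have hends : ∀ w ∈ S, w ∈ a p ++ [p] → w = p := fun w hw h =>
    ha' w (hSP hw) p hp w (by simp) h
  have hstarts : ∀ w ∈ S, w ∈ q :: b q → w = q := fun w hw h =>
    hb' w (hSQ hw) q hq w (by simp) h
  obtain ⟨l₁, l₂, hl⟩ := List.append_of_mem hvp
  obtain ⟨m₁, m₂, hm⟩ := List.append_of_mem hvq
  obtain ⟨⟨hac, ⟨s, hsA, hs⟩, -⟩, han⟩ := ha p hp
  obtain ⟨⟨hbc, -, ⟨t, htB, ht⟩⟩, hbn⟩ := hb q hq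
  rw [hl] at hac hs
  rw [hm] at hbc ht
  -- One route up to `v` followed by the other from `v` on is a walk from `A` to `B`, so it meets
  -- `S`. By disjointness, a node of `S` on the first route is its end `p`, and one on the second is
  -- its start `q`; as both routes are simple, this node is `v`.
  obtain ⟨w, hw, hwS⟩ := hS (l₁ ++ v :: m₂)
    { chain := List.isChain_split.2 ⟨(List.isChain_split.1 hac).1, (List.isChain_split.1 hbc).2⟩
      head := ⟨s, hsA, by rw [head?_append_cons l₁ m₂ l₂, hs]⟩
      last := ⟨t, htB, by rw [List.getLast?_append_cons] at ht ⊢; exact ht⟩ }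
  have hvS : w = v → v ∈ S ∧ v = p ∧ v = q := by
    rintro rfl
    exact ⟨hwS, hends w hwS hvp, hstarts w hwS hvq⟩
  rcases List.mem_append.1 hw with h | h
  · exfalso
    have hwp : w = p := hends w hwS (by rw [hl]; exact List.mem_append_left _ h)
    have hlast : p ∈ v :: l₂ := by
      have h1 : (a p ++ [p]).getLast? = some p := by simp
      rw [hl, List.getLast?_append_cons] at h1
      exact List.mem_of_getLast? h1
    rw [hl] at han
    exact List.disjoint_of_nodup_append han (hwp ▸ h) hlast
  · rcases List.mem_cons.1 h with h | h
    · exact hvS h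
    · exfalso
      have hwq : w = q := hstarts w hwS (by rw [hm]; simp [h])
      rw [hwq] at h
      cases m₁ with
      | nil =>
        obtain ⟨h1, h2⟩ := List.cons.inj hm
        rw [h2] at hbn
        exact (List.nodup_cons.1 hbn).1 h
      | cons c m =>
        obtain ⟨h1, h2⟩ := List.cons.inj hm
        rw [h2] at hbn
        exact (List.nodup_cons.1 hbn).1 (by simp [h])

/-- Truncate the route at its first node in `P`. Thus whatever separates `A` from `P` after the
deletion of an arc leaving `P` separates `A` from `B` before it, once `P` is itself a separator. -/
theorem IsRoute.erase_of_tail_notMem [DecidableEq V] {E : Finset (V × V)} {A B P : Finset V}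
    {x y : V} (hx : x ∈ P) {l : List V} (hl : IsRoute E A B l) (hP : ∃ v ∈ l, v ∈ P) :
    ∃ l' ⊆ l, IsRoute (E.erase (x, y)) A P l' := by
  obtain ⟨l₁, p, l₂, rfl, hp, h'⟩ := exists_first_of_mem l hP
  refine ⟨l₁ ++ [p], ?_, ?_, ?_, ⟨p, hp, by simp⟩⟩
  · intro v hv
    simp only [List.mem_append, List.mem_cons, List.not_mem_nil, or_false] at hv ⊢
    tauto
  · exact isChain_erase_of_tail_notMem l₁ p (fun h => h' x h hx) (List.isChain_split.1 hl.chain).1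
  · obtain ⟨a, ha, h⟩ := hl.head
    exact ⟨a, ha, by rw [head?_append_cons l₁ [] l₂, h]⟩

theorem IsRoute.erase_of_head_notMem [DecidableEq V] {E : Finset (V × V)} {A B Q : Finset V}
    {x y : V} (hy : y ∈ Q) {l : List V} (hl : IsRoute E A B l) (hQ : ∃ v ∈ l, v ∈ Q) :
    ∃ l' ⊆ l, IsRoute (E.erase (x, y)) Q B l' := by
  obtain ⟨l₁, q, l₂, rfl, hq, h'⟩ := exists_last_of_mem l hQ
  refine ⟨q :: l₂, List.subset_append_right _ _, ?_, ⟨q, hq, by simp⟩, ?_⟩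
  · exact isChain_erase_of_head_notMem l₂ q (fun h => h' y h hy) (List.isChain_split.1 hl.chain).2
  · obtain ⟨b, hb, h⟩ := hl.last
    exact ⟨b, hb, by rwa [List.getLast?_append_cons] at h⟩

/-- If every separator has at least `k` nodes, there are `k` disjoint paths from `A` to `B`. -/
theorem exists_disjoint_routes [DecidableEq V] (k : ℕ) (E : Finset (V × V)) (A B : Finset V)
    (h : ∀ X, IsSeparator E A B X → k ≤ X.card) :
    ∃ p : Fin k → List V, (∀ i, IsRoute E A B (p i) ∧ (p i).Nodup) ∧
      ∀ i j, i ≠ j → (p i).Disjoint (p j) := by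
  induction hm : E.card generalizing E A B with
  | zero =>
    obtain rfl := Finset.card_eq_zero.1 hm
    -- Without arcs, every route is a single node.
    have hAB : IsSeparator ∅ A B (A ∩ B) := by
      rintro l ⟨hc, ⟨a, ha, hla⟩, b, hb, hlb⟩
      match l, hc, hla, hlb with
      | [c], _, hla, hlb =>
        obtain rfl : c = a := by simpa using hla
        obtain rfl : c = b := by simpa using hlb
        exact ⟨c, by simp, by simp [ha, hb]⟩
      | c :: d :: l, hc, _, _ => simp at hc
    obtain ⟨X, hX, hXk⟩ := Finset.exists_subset_card_eq (h _ hAB)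
    refine ⟨fun i => [(X.equivFinOfCardEq hXk).symm i], ?_, ?_⟩
    · intro i
      have := Finset.mem_inter.1 (hX ((X.equivFinOfCardEq hXk).symm i).2)
      exact ⟨⟨List.isChain_singleton _, ⟨_, this.1, rfl⟩, ⟨_, this.2, rfl⟩⟩, by simp⟩
    · intro i j hij
      simp only [List.disjoint_singleton, List.mem_singleton]
      intro h'
      exact hij ((X.equivFinOfCardEq hXk).symm.injective (Subtype.ext h'.symm))
  | succ m ih =>
    obtain ⟨⟨x, y⟩, he⟩ := Finset.card_pos.1 (by omega : 0 < E.card)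
    have hcard : (E.erase (x, y)).card = m := by rw [Finset.card_erase_of_mem he]; omega
    by_cases hk : ∀ X, IsSeparator (E.erase (x, y)) A B X → k ≤ X.card
    · obtain ⟨p, h1, h2⟩ := ih _ A B hk hcard
      refine ⟨p, fun i => ⟨⟨(h1 i).1.chain.imp fun _ _ => Finset.mem_of_mem_erase,
        (h1 i).1.head, (h1 i).1.last⟩, (h1 i).2⟩, h2⟩
    push Not at hk
    obtain ⟨S, hS, hSk⟩ := hk
    -- A route that avoids one end of the deleted arc survives the deletion. So `S` together with
    -- `x` or with `y` separates in `E`, which forces `S` to have exactly `k - 1` nodes and to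
    -- contain neither end.
    have meets : ∀ z, z = x ∨ z = y → IsSeparator E A B (insert z S) := by
      intro z hz l hl
      by_cases hzl : z ∈ l
      · exact ⟨z, hzl, Finset.mem_insert_self _ _⟩
      · have hc : l.IsChain fun u v => (u, v) ∈ E.erase (x, y) := by
          rcases hz with rfl | rfl
          · rcases List.eq_nil_or_concat' l with rfl | ⟨l', p, rfl⟩
            · exact List.isChain_nil
            · exact isChain_erase_of_tail_notMem l' p (fun h => hzl (List.mem_append_left _ h)) hl.chain
          · cases l with
            | nil => exact List.isChain_nil
            | cons p l => exact isChain_erase_of_head_notMem l p (fun h => hzl (by simp [h])) hl.chain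
        obtain ⟨v, hv, hvS⟩ := hS l ⟨hc, hl.head, hl.last⟩
        exact ⟨v, hv, Finset.mem_insert_of_mem hvS⟩
    have notMem : ∀ z, z = x ∨ z = y → z ∉ S := by
      intro z hz hzS
      have := h _ (meets z hz)
      rw [Finset.insert_eq_of_mem hzS] at this
      omega
    have hxS := notMem x (Or.inl rfl)
    have hyS := notMem y (Or.inr rfl)
    have hSk' : S.card + 1 = k := by
      have := h _ (meets x (Or.inl rfl))
      rw [Finset.card_insert_of_notMem hxS] at this
      omega
    have hPk : (insert x S).card = k := by rw [Finset.card_insert_of_notMem hxS, hSk']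
    have hQk : (insert y S).card = k := by rw [Finset.card_insert_of_notMem hyS, hSk']
    obtain ⟨α, hα, hα'⟩ := ih (E.erase (x, y)) A (insert x S) (by
      intro X hX
      refine h X fun l hl => ?_
      obtain ⟨l', hl', hr⟩ := hl.erase_of_tail_notMem (y := y) (Finset.mem_insert_self x S)
        (meets x (Or.inl rfl) l hl)
      obtain ⟨v, hv, hvX⟩ := hX l' hr
      exact ⟨v, hl' hv, hvX⟩) hcard
    obtain ⟨β, hβ, hβ'⟩ := ih (E.erase (x, y)) (insert y S) B (by
      intro X hX
      refine h X fun l hl => ?_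
      obtain ⟨l', hl', hr⟩ := hl.erase_of_head_notMem (x := x) (Finset.mem_insert_self y S)
        (meets y (Or.inr rfl) l hl)
      obtain ⟨v, hv, hvX⟩ := hX l' hr
      exact ⟨v, hl' hv, hvX⟩) hcard
    obtain ⟨a, ha, ha'⟩ := exists_routes_by_last hPk α hα hα'
    obtain ⟨b, hb, hb'⟩ := exists_routes_by_head hQk β hβ hβ'
    have meet := @routes_meet_in_separator V _ _ _ _ _ S hS (Finset.subset_insert x S)
      (Finset.subset_insert y S) a b ha ha' hb hb'
    -- The route ending at `p` is continued by the one starting at `φ p`: directly if `p ∈ S`, and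
    -- along the deleted arc if `p = x`.
    let φ : V → V := fun p => if p = x then y else p
    have hφx : φ x = y := by simp [φ]
    have hφ : ∀ p ∈ S, φ p = p := by
      intro p hp
      have : p ≠ x := fun h => hxS (h ▸ hp)
      simp [φ, this]
    have hφQ : ∀ p ∈ insert x S, φ p ∈ insert y S := by
      intro p hp
      rcases Finset.mem_insert.1 hp with rfl | hp
      · simp [hφx]
      · simp [hφ p hp, hp]
    have hφinj : ∀ p ∈ insert x S, ∀ p' ∈ insert x S, φ p = φ p' → p = p' := by
      intro p hp p' hp' hpp
      rcases Finset.mem_insert.1 hp with h1 | h1 <;> rcases Finset.mem_insert.1 hp' with h2 | h2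
      · rw [h1, h2]
      · rw [h1, hφx, hφ p' h2] at hpp
        exact absurd (hpp ▸ h2) hyS
      · rw [h2, hφx, hφ p h1] at hpp
        exact absurd (hpp ▸ h1) hyS
      · rwa [hφ p h1, hφ p' h2] at hpp
    let c : V → List V := fun p => if p = x then y :: b y else b p
    have hc_sub : ∀ p ∈ insert x S, ∀ v ∈ c p, v ∈ φ p :: b (φ p) := by
      intro p hp v hv
      rcases Finset.mem_insert.1 hp with rfl | hp
      · simpa [c, φ] using hv
      · have hpx : p ≠ x := fun h => hxS (h ▸ hp)
        rw [hφ p hp]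
        exact List.mem_cons_of_mem _ (by simpa [c, hpx] using hv)
    have hcross : ∀ p ∈ insert x S, ∀ p' ∈ insert x S, ∀ v, v ∈ a p ++ [p] →
        v ∈ φ p' :: b (φ p') → p ∈ S ∧ p' = p ∧ v = p := by
      intro p hp p' hp' v h1 h2
      obtain ⟨h3, rfl, h5⟩ := meet hp (hφQ p' hp') h1 h2
      refine ⟨h3, ?_, rfl⟩
      exact hφinj p' hp' v hp (by rw [← h5, hφ v h3])
    have hnodup : ∀ p ∈ insert x S, (a p ++ p :: c p).Nodup := by
      intro p hp
      rw [List.append_cons]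
      refine List.Nodup.append (ha p hp).2 ?_ ?_
      · rcases Finset.mem_insert.1 hp with rfl | hp
        · simpa [c] using (hb y (by simp)).2
        · have hpx : p ≠ x := fun h => hxS (h ▸ hp)
          simpa [c, hpx] using (List.nodup_cons.1 (hb p (by simp [hp])).2).2
      · intro v hv hv'
        obtain ⟨hpS, -, rfl⟩ := hcross p hp p hp v hv (hc_sub p hp v hv')
        have hpx : v ≠ x := fun h => hxS (h ▸ hpS)
        simp only [c, hpx, if_false] at hv'
        exact (List.nodup_cons.1 (hb v (by simp [hpS])).2).1 hv'
    have hroute : ∀ p ∈ insert x S, IsRoute E A B (a p ++ p :: c p) := by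
      intro p hp
      obtain ⟨⟨hac, ⟨s, hs, hs'⟩, -⟩, -⟩ := ha p hp
      have hmono : ∀ l : List V, l.IsChain (fun u v => (u, v) ∈ E.erase (x, y)) →
          l.IsChain fun u v => (u, v) ∈ E := fun l hl =>
        hl.imp fun _ _ => Finset.mem_of_mem_erase
      obtain ⟨hbc, -, t, ht, ht'⟩ := (hb (φ p) (hφQ p hp)).1
      have hpc : (p :: c p).IsChain (fun u v => (u, v) ∈ E) ∧ (p :: c p).getLast? = some t := by
        rcases Finset.mem_insert.1 hp with rfl | hp
        · rw [hφx] at hbc ht'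
          simp only [c, if_true]
          exact ⟨List.isChain_cons_cons.2 ⟨he, hmono _ hbc⟩, by rw [List.getLast?_cons_cons, ht']⟩
        · have hpx : p ≠ x := fun h => hxS (h ▸ hp)
          rw [hφ p hp] at hbc ht'
          simp only [c, hpx, if_false]
          exact ⟨hmono _ hbc, ht'⟩
      refine ⟨List.isChain_split.2 ⟨hmono _ hac, hpc.1⟩, ⟨s, hs, ?_⟩, t, ht, ?_⟩
      · rw [head?_append_cons (a p) (c p) [], hs']
      · rw [List.getLast?_append_cons, hpc.2]
    have hmem : ∀ p ∈ insert x S, ∀ v ∈ a p ++ p :: c p,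
        v ∈ a p ++ [p] ∨ v ∈ φ p :: b (φ p) := by
      intro p hp v hv
      rw [List.append_cons, List.mem_append] at hv
      exact hv.imp_right (hc_sub p hp v)
    let e := (insert x S).equivFinOfCardEq hPk
    refine ⟨fun i => a (e.symm i) ++ (e.symm i : V) :: c (e.symm i),
      fun i => ⟨hroute _ (e.symm i).2, hnodup _ (e.symm i).2⟩, ?_⟩
    intro i j hij v hvi hvj
    refine hij (e.symm.injective (Subtype.ext ?_))
    have hi := (e.symm i).2
    have hj := (e.symm j).2
    rcases hmem _ hi v hvi with h1 | h1 <;> rcases hmem _ hj v hvj with h2 | h2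
    · exact ha' _ hi _ hj v h1 h2
    · exact (hcross _ hi _ hj v h1 h2).2.1.symm
    · exact (hcross _ hj _ hi v h2 h1).2.1
    · exact hφinj _ hi _ hj (hb' _ (hφQ _ hi) _ (hφQ _ hj) v h1 h2)

end Menger

end NodeConn

/-! ### Separating bisets from a bound on the local connectivity -/

namespace NodeConn

section Connectivity

variable {V : Type*}

theorem exists_path_of_list {G : SimpleGraph V} {s t : V} (l : List V)
    (hc : (s :: l ++ [t]).IsChain G.Adj) (hn : (s :: l ++ [t]).Nodup) :
    ∃ q : G.Path s t, (q : G.Walk s t).support = s :: l ++ [t] := by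
  have hne : s :: l ++ [t] ≠ [] := by simp
  have hs : (s :: l ++ [t]).head hne = s := by simp
  have ht : (s :: l ++ [t]).getLast hne = t := by simp
  have hsupp : ((SimpleGraph.Walk.ofSupport _ hne hc).copy hs ht).support = s :: l ++ [t] := by
    rw [SimpleGraph.Walk.support_copy, SimpleGraph.Walk.support_ofSupport]
  refine ⟨⟨(SimpleGraph.Walk.ofSupport _ hne hc).copy hs ht, ?_⟩, hsupp⟩
  exact SimpleGraph.Walk.IsPath.mk' (by rw [hsupp]; exact hn)

theorem card_le_kappa {G : SimpleGraph V} {s t : V} {ι : Type*} [Fintype ι]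
    (L : ι → List V) (hinj : Function.Injective L)
    (hc : ∀ i, (s :: L i ++ [t]).IsChain G.Adj) (hn : ∀ i, (s :: L i ++ [t]).Nodup)
    (hd : ∀ i j, i ≠ j → (L i).Disjoint (L j)) : (Fintype.card ι : ℕ∞) ≤ kappa G s t := by
  classical
  choose q hq using fun i => exists_path_of_list (L i) (hc i) (hn i)
  have hqinj : Function.Injective q := by
    intro i j hij
    have h := hq i
    rw [hij, hq j] at h
    exact hinj (by simpa using h.symm)
  have hdisj : InternallyDisjoint (Finset.univ.image q) := by
    intro a ha b hb hab v hva hvb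
    obtain ⟨i, -, rfl⟩ := Finset.mem_image.1 ha
    obtain ⟨j, -, rfl⟩ := Finset.mem_image.1 hb
    have hij : i ≠ j := fun h => hab (by rw [h])
    rw [hq] at hva hvb
    simp only [List.cons_append, List.mem_cons, List.mem_append, List.not_mem_nil,
      or_false] at hva hvb
    have := hd i j hij (a := v)
    tauto
  have := le_iSup₂ (f := fun (P : Finset (G.Path s t)) (_ : InternallyDisjoint P) =>
    (P.card : ℕ∞)) (Finset.univ.image q) hdisj
  rwa [Finset.card_image_of_injective _ hqinj, Finset.card_univ] at this

/-! ### Menger's theorem for mixed cuts -/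

variable [Fintype V]

open Classical in
/-- The arcs of `G` that avoid `s` and `t`. -/
noncomputable def innerArcs (G : SimpleGraph V) (s t : V) : Finset (V × V) :=
  Finset.univ.filter fun e =>
    G.Adj e.1 e.2 ∧ (e.1 ≠ s ∧ e.1 ≠ t) ∧ e.2 ≠ s ∧ e.2 ≠ t

theorem mem_innerArcs {G : SimpleGraph V} {s t u v : V} :
    (u, v) ∈ innerArcs G s t ↔ G.Adj u v ∧ (u ≠ s ∧ u ≠ t) ∧ v ≠ s ∧ v ≠ t := by
  simp [innerArcs]

open Classical in
/-- The neighbours of `s` other than `t`. -/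
noncomputable def otherNeighbors (G : SimpleGraph V) (s t : V) : Finset V :=
  Finset.univ.filter fun v => G.Adj s v ∧ v ≠ t

theorem mem_otherNeighbors {G : SimpleGraph V} {s t v : V} :
    v ∈ otherNeighbors G s t ↔ G.Adj s v ∧ v ≠ t := by
  simp [otherNeighbors]

theorem ne_ends_of_isChain {G : SimpleGraph V} {s t : V} :
    ∀ l : List V, l.IsChain (fun u v => (u, v) ∈ innerArcs G s t) →
      (∀ a, l.head? = some a → a ≠ s ∧ a ≠ t) → ∀ v ∈ l, v ≠ s ∧ v ≠ t
  | [], _, _ => by simp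
  | [a], _, h => by simpa using h a
  | a :: b :: l, hc, h => by
    rw [List.isChain_cons_cons] at hc
    intro v hv
    rcases List.mem_cons.1 hv with rfl | hv
    · exact h v rfl
    · refine ne_ends_of_isChain (b :: l) hc.2 ?_ v hv
      intro c hbc
      obtain rfl : b = c := by simpa using hbc
      exact (mem_innerArcs.1 hc.1).2.2

-- Label `X` by 1, `s` and the nodes reached by routes avoiding `X` by 2, and the rest by 0. The
-- only edge that can lead from label 2 to label 0 is `st`, so the cut consists of at most `X` and
-- this edge.
open Classical in
theorem separator_card {G : SimpleGraph V} {s t : V} (hst : s ≠ t) {k : ℕ}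
    (h : ∀ f : V → Fin 3, f s = 2 → f t = 0 → k < cutSize G f) {X : Finset V}
    (hX : IsSeparator (innerArcs G s t) (otherNeighbors G s t) (otherNeighbors G t s) X) :
    k + 1 ≤ X.card + (if G.Adj s t then 1 else 0) := by
  classical
  let R : V → Prop := fun v => ∃ l, IsRoute (innerArcs G s t) (otherNeighbors G s t) {v} l ∧
    ∀ x ∈ l, x ∉ X
  let f : V → Fin 3 := fun v =>
    if v = s then 2 else if v = t then 0 else if v ∈ X then 1 else if R v then 2 else 0
  have hfs : f s = 2 := by simp [f]
  have hft : f t = 0 := by simp [f, hst.symm]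
  have hsub : cutPairs G f ⊆
      X.image (fun v => (v, v)) ∪ ({(s, t)} : Finset (V × V)).filter fun _ => G.Adj s t := by
    rintro ⟨u, v⟩ he
    rw [Finset.mem_union, Finset.mem_image, Finset.mem_filter, Finset.mem_singleton]
    rcases mem_cutPairs.1 he with ⟨huv, hu⟩ | ⟨huv, hu, hv⟩
    · obtain rfl : u = v := huv
      refine Or.inl ⟨u, ?_, rfl⟩
      by_contra huX
      simp only [f, huX, if_false] at hu
      split_ifs at hu <;> revert hu <;> decide
    · right
      simp only at huv hu hv
      have hvs : v ≠ s := by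
        rintro rfl
        rw [hfs] at hv
        exact absurd hv (by decide)
      have hut : u ≠ t := by
        rintro rfl
        rw [hft] at hu
        exact absurd hu (by decide)
      have hvX : v ≠ t → v ∉ X ∧ ¬ R v := by
        intro hvt
        constructor
        · intro hvX
          simp [f, hvs, hvt, hvX] at hv
        · intro hR
          by_cases hvX : v ∈ X
          · simp [f, hvs, hvt, hvX] at hv
          · simp [f, hvs, hvt, hvX, hR] at hv
      by_cases hus : u = s
      · subst hus
        by_cases hvt : v = t
        · exact ⟨by rw [hvt], by rwa [hvt] at huv⟩
        · refine absurd ⟨[v], ⟨List.isChain_singleton _,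
            ⟨v, mem_otherNeighbors.2 ⟨huv, hvt⟩, rfl⟩, ⟨v, by simp, rfl⟩⟩, ?_⟩ (hvX hvt).2
          simpa using (hvX hvt).1
      · have hR : R u := by
          by_contra hR
          by_cases huX : u ∈ X
          · simp [f, hus, hut, huX] at hu
          · simp [f, hus, hut, huX, hR] at hu
        obtain ⟨l, ⟨hc, hh, b, hb, hlast⟩, hlX⟩ := hR
        obtain rfl : b = u := by simpa using hb
        exfalso
        by_cases hvt : v = t
        · subst hvt
          obtain ⟨x, hx, hxX⟩ := hX l ⟨hc, hh, b, mem_otherNeighbors.2 ⟨huv.symm, hus⟩, hlast⟩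
          exact hlX x hx hxX
        · refine (hvX hvt).2 ⟨l ++ [v], ⟨?_, ?_, v, by simp, by simp⟩, ?_⟩
          · refine hc.append (List.isChain_singleton _) ?_
            intro x hx y hy
            obtain rfl : b = x := by rw [hlast] at hx; simpa using hx
            obtain rfl : v = y := by simpa using hy
            exact mem_innerArcs.2 ⟨huv, ⟨hus, hut⟩, hvs, hvt⟩
          · obtain ⟨a, ha, hla⟩ := hh
            exact ⟨a, ha, by simp [List.head?_append, hla]⟩
          · intro x hx
            rcases List.mem_append.1 hx with hx | hx
            · exact hlX x hx
            · obtain rfl : x = v := by simpa using hx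
              exact (hvX hvt).1
  have h1 := h f hfs hft
  have h2 := Finset.card_le_card hsub
  have h3 := Finset.card_union_le (X.image fun v => (v, v))
    (({(s, t)} : Finset (V × V)).filter fun _ => G.Adj s t)
  have h4 : (X.image fun v => (v, v)).card ≤ X.card := Finset.card_image_le
  have h5 : (({(s, t)} : Finset (V × V)).filter fun _ => G.Adj s t).card ≤
      (if G.Adj s t then 1 else 0) := by
    by_cases hadj : G.Adj s t <;> simp [hadj]
  unfold cutSize at h1
  omega

/-- The hard direction of Menger's theorem, for mixed cuts. -/
theorem exists_label_of_kappa {G : SimpleGraph V} {s t : V} (hst : s ≠ t) {k : ℕ}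
    (h : ¬ ((k + 1 : ℕ) : ℕ∞) ≤ kappa G s t) :
    ∃ f : V → Fin 3, cutSize G f ≤ k ∧ Separates f s t := by
  classical
  by_contra hcon
  have hlarge : ∀ f : V → Fin 3, f s = 2 → f t = 0 → k < cutSize G f := by
    intro f hs ht
    by_contra hf
    exact hcon ⟨f, by omega, Or.inl ⟨hs, ht⟩⟩
  have hroute : ∀ l, IsRoute (innerArcs G s t) (otherNeighbors G s t) (otherNeighbors G t s) l →
      l.Nodup → l ≠ [] ∧ (s :: l ++ [t]).IsChain G.Adj ∧ (s :: l ++ [t]).Nodup := by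
    rintro l ⟨hc, ⟨a, ha, hla⟩, b, hb, hlb⟩ hn
    have ha' := mem_otherNeighbors.1 ha
    have hb' := mem_otherNeighbors.1 hb
    have hends := ne_ends_of_isChain l hc (by
      intro c hlc
      obtain rfl : a = c := by rw [hla] at hlc; simpa using hlc
      exact ⟨ha'.1.ne', ha'.2⟩)
    refine ⟨by rintro rfl; simp at hla, ?_, ?_⟩
    · rw [List.cons_append, List.isChain_cons]
      refine ⟨?_, (hc.imp fun u v huv => (mem_innerArcs.1 huv).1).append
        (List.isChain_singleton _) ?_⟩
      · intro y hy
        obtain rfl : a = y := by simpa [List.head?_append, hla] using hy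
        exact ha'.1
      · intro x hx y hy
        obtain rfl : b = x := by rw [hlb] at hx; simpa using hx
        obtain rfl : t = y := by simpa using hy
        exact hb'.1.symm
    · rw [List.cons_append, List.nodup_cons]
      refine ⟨?_, hn.append (List.nodup_singleton _) ?_⟩
      · simp only [List.mem_append, List.mem_singleton, not_or]
        exact ⟨fun hs => (hends s hs).1 rfl, hst⟩
      · intro v hv hv'
        exact (hends v hv).2 (by simpa using hv')
  have inj_of_disjoint : ∀ {ι : Type} (L : ι → List V), (∀ i, L i ≠ []) →
      (∀ i j, i ≠ j → (L i).Disjoint (L j)) → Function.Injective L := by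
    intro ι L hne hd i j hij
    by_contra hne'
    obtain ⟨v, hv⟩ := List.exists_mem_of_ne_nil _ (hne i)
    exact hd i j hne' hv (hij ▸ hv)
  by_cases hadj : G.Adj s t
  · obtain ⟨p, hp, hd⟩ := exists_disjoint_routes k (innerArcs G s t) (otherNeighbors G s t)
      (otherNeighbors G t s) (by
        intro X hX
        have := separator_card hst hlarge hX
        simpa [hadj] using this)
    have hp' := fun i => hroute _ (hp i).1 (hp i).2
    have hinj := inj_of_disjoint p (fun i => (hp' i).1) hd
    -- `none` stands for the edge `st`, a path without inner nodes; it supplies the path missing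
    -- from the `k` inner routes.
    let L : Option (Fin k) → List V := fun i => i.elim [] p
    have := card_le_kappa (G := G) (s := s) (t := t) L ?_ ?_ ?_ ?_
    · apply h
      simpa using this
    · rintro (_ | i) (_ | j) hij
      · rfl
      · exact absurd hij.symm (hp' j).1
      · exact absurd hij (hp' i).1
      · rw [hinj hij]
    · rintro (_ | i)
      · simpa [L] using hadj
      · exact (hp' i).2.1
    · rintro (_ | i)
      · simpa [L] using hst
      · exact (hp' i).2.2
    · rintro (_ | i) (_ | j) hij
      · exact absurd rfl hij
      · exact List.disjoint_nil_left _
      · exact List.disjoint_nil_right _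
      · exact hd i j fun h => hij (by rw [h])
  · obtain ⟨p, hp, hd⟩ := exists_disjoint_routes (k + 1) (innerArcs G s t) (otherNeighbors G s t)
      (otherNeighbors G t s) (by
        intro X hX
        have := separator_card hst hlarge hX
        simpa [hadj] using this)
    have hp' := fun i => hroute _ (hp i).1 (hp i).2
    have := card_le_kappa p (inj_of_disjoint p (fun i => (hp' i).1) hd) (fun i => (hp' i).2.1)
      (fun i => (hp' i).2.2) hd
    apply h
    simpa using this

/-- All nodes other than `s` and `t` form the boundary, and the only possible cut edge is `st`. This
keeps stored cuts small when `k` exceeds `n`. -/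
theorem exists_label_le_card (G : SimpleGraph V) {s t : V} (hst : s ≠ t) :
    ∃ f : V → Fin 3, cutSize G f ≤ Fintype.card V ∧ Separates f s t := by
  classical
  let f : V → Fin 3 := fun v => if v = s then 2 else if v = t then 0 else 1
  have h2 : ∀ v, f v = 2 → v = s := by
    intro v hv
    by_contra h
    simp only [f, h, if_false] at hv
    split_ifs at hv <;> revert hv <;> decide
  have h0 : ∀ v, f v = 0 → v = t := by
    intro v hv
    by_contra h
    simp only [f, h, if_false] at hv
    split_ifs at hv <;> revert hv <;> decide
  have h1 : f s ≠ 1 := by simp [f]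
  refine ⟨f, ?_, Or.inl ⟨by simp [f], by simp [f, hst.symm]⟩⟩
  refine (Finset.card_le_card_of_injOn Prod.fst (t := Finset.univ) (by simp) ?_)
  rintro ⟨a, b⟩ hab ⟨c, d⟩ hcd (rfl : a = c)
  rcases mem_cutPairs.1 (Finset.mem_coe.1 hab) with ⟨e1, e2⟩ | ⟨-, e2, e3⟩ <;>
    rcases mem_cutPairs.1 (Finset.mem_coe.1 hcd) with ⟨e1', e2'⟩ | ⟨-, e2', e3'⟩ <;>
    simp only at *
  · rw [← e1, ← e1']
  · exact absurd (h2 _ e2' ▸ e2) h1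
  · exact absurd (h2 _ e2 ▸ e2') h1
  · rw [h0 _ e3, h0 _ e3']

end Connectivity

/-! ### Mixed cuts as sets and as memory words -/

section Storage

variable {n : ℕ}

/-- Cut edges are listed only from inside to outside, so no edge appears in both orientations. -/
theorem decodeElem_injOn (G : SimpleGraph (Fin n)) (f : Fin n → Fin 3) :
    Set.InjOn decodeElem (cutPairs G f : Set (Fin n × Fin n)) := by
  rintro ⟨a, b⟩ hab ⟨c, d⟩ hcd h
  rcases mem_cutPairs.1 (Finset.mem_coe.1 hab) with ⟨e1, e2⟩ | ⟨e1, e2, e3⟩ <;>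
    rcases mem_cutPairs.1 (Finset.mem_coe.1 hcd) with ⟨e1', e2'⟩ | ⟨e1', e2', e3'⟩ <;>
    simp only at e1 e2 e1' e2'
  · subst e1 e1'
    simpa [decodeElem] using h
  · simp [decodeElem, e1, e1'.ne] at h
  · simp [decodeElem, e1', e1.ne] at h
  · simp only [decodeElem, e1.ne, e1'.ne, if_false, Sum.inr.injEq, Sym2.eq_iff] at h
    rcases h with ⟨rfl, rfl⟩ | ⟨rfl, rfl⟩
    · rfl
    · rw [e2] at e3'
      exact absurd e3' (by decide)

/-- The mixed cut of a labelling. -/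
noncomputable def cutSet (G : SimpleGraph (Fin n)) (f : Fin n → Fin 3) :
    Finset (Fin n ⊕ Sym2 (Fin n)) := (cutPairs G f).image decodeElem

theorem inl_mem_cutSet {G : SimpleGraph (Fin n)} {f : Fin n → Fin 3} {v : Fin n} :
    Sum.inl v ∈ cutSet G f ↔ f v = 1 := by
  constructor
  · intro h
    obtain ⟨⟨a, b⟩, hab, h⟩ := Finset.mem_image.1 h
    rcases mem_cutPairs.1 hab with ⟨e1, e2⟩ | ⟨e1, -⟩ <;> simp only at e1
    · subst e1
      obtain rfl : a = v := by simpa [decodeElem] using h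
      exact e2
    · simp [decodeElem, e1.ne] at h
  · intro h
    exact Finset.mem_image.2 ⟨(v, v), mem_cutPairs.2 (Or.inl ⟨rfl, h⟩), by simp [decodeElem]⟩

theorem isCut_cutSet_of_eq {G : SimpleGraph (Fin n)} {f : Fin n → Fin 3} {s t : Fin n}
    (hs : f s = 2) (ht : f t = 0) : IsCut G s t (cutSet G f) := by
  refine ⟨?_, ?_, ?_, ?_⟩
  · rw [inl_mem_cutSet, hs]; decide
  · rw [inl_mem_cutSet, ht]; decide
  · intro e he
    obtain ⟨⟨a, b⟩, hab, h⟩ := Finset.mem_image.1 he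
    rcases mem_cutPairs.1 hab with ⟨e1, e2⟩ | ⟨e1, -⟩ <;> simp only at e1
    · simp [decodeElem, e1] at h
    · simp only [decodeElem, e1.ne, if_false, Sum.inr.injEq] at h
      rw [← h]
      exact e1
  · rintro ⟨w⟩
    have inside : ∀ {a b : Fin n}, (deleteCut G (cutSet G f)).Walk a b → f a = 2 → f b = 2 := by
      intro a b w
      induction w with
      | nil => exact id
      | @cons a c b hac _ ih =>
        intro ha
        obtain ⟨h1, -, h3, h4⟩ := hac
        rw [inl_mem_cutSet] at h3
        refine ih ?_
        rcases label_cases f c with hc | hc | hc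
        · exact absurd (Finset.mem_image.2 ⟨(a, c), mem_cutPairs.2 (Or.inr ⟨h1, ha, hc⟩),
            by simp [decodeElem, h1.ne]⟩) h4
        · exact absurd hc h3
        · exact hc
    have := inside w hs
    rw [ht] at this
    exact absurd this (by decide)

theorem isCut_cutSet {G : SimpleGraph (Fin n)} {f : Fin n → Fin 3} {s t : Fin n}
    (h : Separates f s t) : IsCut G s t (cutSet G f) := by
  rcases h with ⟨hs, ht⟩ | ⟨ht, hs⟩
  · exact isCut_cutSet_of_eq hs ht
  · obtain ⟨h1, h2, h3, h4⟩ := isCut_cutSet_of_eq (G := G) ht hs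
    exact ⟨h2, h1, h3, fun h => h4 h.symm⟩

/-- The words that store the mixed cut of a labelling. -/
noncomputable def encodeCut (G : SimpleGraph (Fin n)) (f : Fin n → Fin 3) : List ℕ :=
  cutSize G f :: (cutPairs G f).toList.flatMap fun e => [(e.1 : ℕ), (e.2 : ℕ)]

theorem length_encodeCut (G : SimpleGraph (Fin n)) (f : Fin n → Fin 3) :
    (encodeCut G f).length = 2 * cutSize G f + 1 := by
  simp [encodeCut, cutSize, List.length_flatMap, mul_comm]

theorem le_of_mem_encodeCut {G : SimpleGraph (Fin n)} {f : Fin n → Fin 3} {x : ℕ}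
    (hx : x ∈ encodeCut G f) : x ≤ max n (cutSize G f) := by
  rcases List.mem_cons.1 hx with rfl | hx
  · exact le_max_right _ _
  · obtain ⟨e, -, he⟩ := List.mem_flatMap.1 hx
    have h1 := e.1.2
    have h2 := e.2.2
    have : x = e.1 ∨ x = e.2 := by simpa using he
    omega

theorem storedAt_cutSet {G : SimpleGraph (Fin n)} {f : Fin n → Fin 3} {mem : List ℕ} {p : ℕ}
    (h : encodeCut G f <+: mem.drop p) : StoredAt mem p (cutSet G f) := by
  refine ⟨(cutPairs G f).toList, ?_, ?_, ?_⟩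
  · refine (Finset.nodup_toList _).map_on ?_
    intro a ha b hb hab
    exact decodeElem_injOn G f (by simpa using ha) (by simpa using hb) hab
  · ext x
    simp [cutSet]
  · simpa [encodeCut, cutSize] using h

theorem card_cutSet_le (G : SimpleGraph (Fin n)) (f : Fin n → Fin 3) :
    (cutSet G f).card ≤ cutSize G f := Finset.card_image_le

theorem exists_prefix_drop_flatten {α : Type*} :
    ∀ (L : List (List α)), ∀ l ∈ L, ∃ q ≤ L.flatten.length, l <+: L.flatten.drop q
  | [], l, h => by simp at h
  | a :: L, l, h => by
    rcases List.mem_cons.1 h with rfl | h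
    · exact ⟨0, Nat.zero_le _, by simp⟩
    · obtain ⟨q, hq, hl⟩ := exists_prefix_drop_flatten L l h
      refine ⟨a.length + q, by simpa using hq, ?_⟩
      simpa [List.drop_append, List.drop_eq_nil_of_le] using hl

end Storage

end NodeConn

/-! ### The query programs -/

namespace WordRAM

/-- The instructions that put the table entry of the input `(s, t)` into register `0`. -/
def lookup : Program :=
  [.load 3 2, .mul 4 0 3, .add 4 4 1, .const 5 1, .add 4 4 5, .load 0 4]

/-- Register 2 is never written, so it holds address 0, where `n` is stored; the added 1 skips that
cell. The program has six instructions; the bound 7 is shared with the longer program. -/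
theorem answers_lookup {w n s t : ℕ} {mem : List ℕ} (hw : 0 < w) (hn : mem.getD 0 0 = n)
    (hnw : n < 2 ^ w) (hst : s * n + t + 1 < 2 ^ w) (hm : mem.getD (s * n + t + 1) 0 < 2 ^ w) :
    Answers lookup w mem 7 s t (mem.getD (s * n + t + 1) 0) := by
  have h1 : 1 < 2 ^ w := Nat.one_lt_two_pow hw.ne'
  have e0 : mem.getD 0 0 % 2 ^ w = n := by rw [hn, Nat.mod_eq_of_lt hnw]
  have e1 : s * n % 2 ^ w = s * n := Nat.mod_eq_of_lt (by omega)
  have e2 : (s * n + t) % 2 ^ w = s * n + t := Nat.mod_eq_of_lt (by omega)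
  have e3 : (s * n + t + 1) % 2 ^ w = s * n + t + 1 := Nat.mod_eq_of_lt hst
  have e4 : 1 % 2 ^ w = 1 := Nat.mod_eq_of_lt h1
  have e5 := Nat.mod_eq_of_lt hm
  simp only [Answers, run, Function.iterate_succ, Function.iterate_zero, Function.comp_apply, id]
  simp [step, lookup, init, State.write, Function.update, e0, e1, e2, e3, e4, e5,
    -List.getD_eq_getElem?_getD]

/-- Register 5 still holds 1, so truncated subtraction turns the entry 0 into 1 and any pointer into
0. -/
theorem answers_lookup_sub {w n s t : ℕ} {mem : List ℕ} (hw : 0 < w) (hn : mem.getD 0 0 = n)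
    (hnw : n < 2 ^ w) (hst : s * n + t + 1 < 2 ^ w) (hm : mem.getD (s * n + t + 1) 0 < 2 ^ w) :
    Answers (lookup ++ [.sub 0 5 0]) w mem 7 s t (1 - mem.getD (s * n + t + 1) 0) := by
  have h1 : 1 < 2 ^ w := Nat.one_lt_two_pow hw.ne'
  have e0 : mem.getD 0 0 % 2 ^ w = n := by rw [hn, Nat.mod_eq_of_lt hnw]
  have e1 : s * n % 2 ^ w = s * n := Nat.mod_eq_of_lt (by omega)
  have e2 : (s * n + t) % 2 ^ w = s * n + t := Nat.mod_eq_of_lt (by omega)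
  have e3 : (s * n + t + 1) % 2 ^ w = s * n + t + 1 := Nat.mod_eq_of_lt hst
  have e4 : 1 % 2 ^ w = 1 := Nat.mod_eq_of_lt h1
  have e5 := Nat.mod_eq_of_lt hm
  have e6 : (1 - mem.getD (s * n + t + 1) 0) % 2 ^ w = 1 - mem.getD (s * n + t + 1) 0 :=
    Nat.mod_eq_of_lt (by omega)
  simp only [Answers, run, Function.iterate_succ, Function.iterate_zero, Function.comp_apply, id]
  simp [step, lookup, init, State.write, Function.update, e0, e1, e2, e3, e4, e5, e6,
    -List.getD_eq_getElem?_getD]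

end WordRAM

/-! ### The data structure -/

namespace NodeConn

section DataStructure

variable {n : ℕ}

/-- The memory: `n`, an `n × n` table, and further words. -/
def layout (tab : Fin n → Fin n → ℕ) (body : List ℕ) : List ℕ :=
  n :: (List.ofFn fun i : Fin (n * n) =>
    tab (finProdFinEquiv.symm i).1 (finProdFinEquiv.symm i).2) ++ body

theorem length_layout (tab : Fin n → Fin n → ℕ) (body : List ℕ) :
    (layout tab body).length = 1 + n * n + body.length := by
  simp [layout]; omega

theorem layout_getD_zero (tab : Fin n → Fin n → ℕ) (body : List ℕ) :
    (layout tab body).getD 0 0 = n := by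
  simp [layout]

theorem layout_getD (tab : Fin n → Fin n → ℕ) (body : List ℕ) (s t : Fin n) :
    (layout tab body).getD (s * n + t + 1) 0 = tab s t := by
  have hi : (finProdFinEquiv (s, t) : ℕ) = s * n + t := by
    simp [finProdFinEquiv, mul_comm, add_comm]
  have hlt : (s * n + t : ℕ) < n * n := hi ▸ (finProdFinEquiv (s, t)).2
  have he : (⟨s * n + t, hlt⟩ : Fin (n * n)) = finProdFinEquiv (s, t) := Fin.ext hi.symm
  simp only [layout, List.cons_append, List.getD_cons_succ]
  rw [List.getD_append _ _ _ _ (by simpa using hlt), List.getD_eq_getElem _ _ (by simpa using hlt),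
    List.getElem_ofFn, he, Equiv.symm_apply_apply]

theorem layout_drop (tab : Fin n → Fin n → ℕ) (body : List ℕ) (q : ℕ) :
    (layout tab body).drop (1 + n * n + q) = body.drop q := by
  rw [← List.drop_drop, layout, List.drop_left' (by simp; omega)]

theorem mem_layout {tab : Fin n → Fin n → ℕ} {body : List ℕ} {x : ℕ} (hx : x ∈ layout tab body) :
    x = n ∨ (∃ s t, tab s t = x) ∨ x ∈ body := by
  rcases List.mem_append.1 hx with hx | hx
  · rcases List.mem_cons.1 hx with hx | hx
    · exact Or.inl hx
    · obtain ⟨i, hi⟩ := (List.mem_ofFn' _ _).1 hx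
      exact Or.inr (Or.inl ⟨_, _, hi⟩)
  · exact Or.inr (Or.inr hx)

theorem exists_label_le_min (G : SimpleGraph (Fin n)) {k : ℕ} {s t : Fin n} (hst : s ≠ t)
    (h : ¬ ((k + 1 : ℕ) : ℕ∞) ≤ kappa G s t) :
    ∃ f, cutSize G f ≤ min k n ∧ Separates f s t := by
  rcases le_total k n with hkn | hkn
  · rw [min_eq_left hkn]
    exact exists_label_of_kappa hst h
  · rw [min_eq_right hkn]
    simpa using exists_label_le_card G hst

/-- All addresses must fit in a word. The left side is at most 17n³, which is below 32n³ ≤ n⁸. -/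
theorem length_bound_lt {n K : ℕ} (hn : 2 ≤ n) (hKn : K ≤ n) :
    1 + n * n + (3 * K + 2) * n * (2 * K + 1) < 2 ^ (8 * (Nat.log 2 n + 1)) := by
  have h1 : n ^ 8 < 2 ^ (8 * (Nat.log 2 n + 1)) := by
    rw [mul_comm, pow_mul]
    exact Nat.pow_lt_pow_left (Nat.lt_pow_succ_log_self (by norm_num) n) (by norm_num)
  have h2 : (3 * K + 2) * n * (2 * K + 1) ≤ 15 * n ^ 3 :=
    calc (3 * K + 2) * n * (2 * K + 1) ≤ (5 * n) * n * (3 * n) := by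
          gcongr <;> omega
      _ = 15 * n ^ 3 := by ring
  have h3 : 2 ^ 5 * n ^ 3 ≤ n ^ 8 :=
    calc 2 ^ 5 * n ^ 3 ≤ n ^ 5 * n ^ 3 := by gcongr
      _ = n ^ 8 := by ring
  have h4 : n * n ≤ n ^ 3 := by
    calc n * n = n * n * 1 := by ring
      _ ≤ n * n * n := by gcongr; omega
      _ = n ^ 3 := by ring
  have h5 : 0 < n ^ 3 := by positivity
  omega

theorem exists_cutData (k : ℕ) (hk : 1 ≤ k) (hn : 2 ≤ n) (G : SimpleGraph (Fin n)) :
    ∃ D : CutData, D.mem.length ≤ 17 * (k ^ 2 * n + n ^ 2) ∧ D.cuts.length ≤ 5 * (k * n) ∧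
      D.Valid (WordRAM.lookup ++ [.sub 0 5 0]) WordRAM.lookup (8 * (Nat.log 2 n + 1)) 7 G k := by
  classical
  have hKn : min k n ≤ n := min_le_right _ _
  have hKk : min k n ≤ k := min_le_left _ _
  generalize hKdef : min k n = K at hKn hKk
  obtain ⟨F₀, hF₀card, hF₀size, hF₀sep⟩ := exists_separating_family G K Finset.univ
  rw [Finset.card_univ, Fintype.card_fin] at hF₀card
  -- Bisets that separate no pair are dropped, since every listed cut must be a cut for some two
  -- distinct nodes.
  set F := F₀.filter fun f => ∃ s t, Separates f s t with hF
  have hFcard : F.card ≤ (3 * K + 2) * n := (Finset.card_filter_le _ _).trans hF₀card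
  have hFsize : ∀ f ∈ F, cutSize G f ≤ K := fun f hf => hF₀size f (Finset.mem_filter.1 hf).1
  have hFsep : ∀ s t, ∃ f, s ≠ t ∧ ¬ ((k + 1 : ℕ) : ℕ∞) ≤ kappa G s t →
      f ∈ F ∧ Separates f s t := by
    intro s t
    by_cases h : s ≠ t ∧ ¬ ((k + 1 : ℕ) : ℕ∞) ≤ kappa G s t
    · obtain ⟨f, hf, hsep⟩ := hF₀sep s (Finset.mem_univ _) t (Finset.mem_univ _)
        (hKdef ▸ exists_label_le_min G h.1 h.2)
      exact ⟨f, fun _ => ⟨Finset.mem_filter.2 ⟨hf, s, t, hsep⟩, hsep⟩⟩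
    · exact ⟨⊤, fun h' => absurd h' h⟩
  choose g hg using hFsep
  set body := (F.toList.map (encodeCut G)).flatten with hbody
  have hbody_len : body.length ≤ (3 * K + 2) * n * (2 * K + 1) := by
    rw [hbody, List.length_flatten]
    refine (List.sum_le_card_nsmul _ (2 * K + 1) ?_).trans ?_
    · intro x hx
      simp only [List.map_map, List.mem_map, Finset.mem_toList, Function.comp_apply] at hx
      obtain ⟨f, hf, rfl⟩ := hx
      have := hFsize f hf
      rw [length_encodeCut]
      omega
    · simpa using Nat.mul_le_mul_right (2 * K + 1) hFcard
  have hbody_mem : ∀ x ∈ body, x ≤ n := by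
    intro x hx
    obtain ⟨l, hl, hxl⟩ := List.mem_flatten.1 hx
    obtain ⟨f, hf, rfl⟩ := List.mem_map.1 hl
    have := hFsize f (Finset.mem_toList.1 hf)
    have := le_of_mem_encodeCut hxl
    omega
  have hq : ∀ f, ∃ q ≤ body.length, f ∈ F → encodeCut G f <+: body.drop q := by
    intro f
    by_cases hf : f ∈ F
    · obtain ⟨q, h1, h2⟩ := exists_prefix_drop_flatten (F.toList.map (encodeCut G)) (encodeCut G f)
        (List.mem_map_of_mem (Finset.mem_toList.2 hf))
      exact ⟨q, h1, fun _ => h2⟩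
    · exact ⟨0, Nat.zero_le _, fun h => absurd h hf⟩
  choose q hq_le hq using hq
  -- The entry 0 is free to mean κ(s,t) ≥ k + 1 because pointers are at least `1 + n * n`, the
  -- address where the cuts begin.
  let tab : Fin n → Fin n → ℕ := fun s t =>
    if s ≠ t ∧ ¬ ((k + 1 : ℕ) : ℕ∞) ≤ kappa G s t then 1 + n * n + q (g s t) else 0
  have hstored : ∀ f ∈ F, StoredAt (layout tab body) (1 + n * n + q f) (cutSet G f) := by
    intro f hf
    refine storedAt_cutSet ?_
    rw [layout_drop]
    exact hq f hf
  have hcard : ∀ f ∈ F, (cutSet G f).card ≤ k := fun f hf =>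
    (card_cutSet_le G f).trans ((hFsize f hf).trans hKk)
  have hword := length_bound_lt hn hKn
  have hnn : n ≤ n * n := Nat.le_mul_of_pos_left n (by omega)
  have htab : ∀ s t, tab s t < 2 ^ (8 * (Nat.log 2 n + 1)) := by
    intro s t
    have := hq_le (g s t)
    simp only [tab]
    split_ifs <;> omega
  have hidx : ∀ s t : Fin n, (s * n + t + 1 : ℕ) < 2 ^ (8 * (Nat.log 2 n + 1)) := by
    intro s t
    have h1 : (s + 1 : ℕ) * n ≤ n * n := Nat.mul_le_mul_right n s.2
    have h2 := t.2
    rw [Nat.add_mul] at h1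
    omega
  have hcut : ∀ s t : Fin n, WordRAM.Answers WordRAM.lookup (8 * (Nat.log 2 n + 1))
      (layout tab body) 7 s t (tab s t) := by
    intro s t
    have := WordRAM.answers_lookup (s := s) (t := t) (by omega) (layout_getD_zero tab body)
      (by omega) (hidx s t) (by rw [layout_getD]; exact htab s t)
    rwa [layout_getD] at this
  have hcon : ∀ s t : Fin n, WordRAM.Answers (WordRAM.lookup ++ [.sub 0 5 0])
      (8 * (Nat.log 2 n + 1)) (layout tab body) 7 s t (1 - tab s t) := by
    intro s t
    have := WordRAM.answers_lookup_sub (s := s) (t := t) (by omega) (layout_getD_zero tab body)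
      (by omega) (hidx s t) (by rw [layout_getD]; exact htab s t)
    rwa [layout_getD] at this
  refine ⟨⟨layout tab body, F.toList.map fun f => 1 + n * n + q f⟩, ?_, ?_, ?_, ?_, ?_, ?_, ?_⟩
  -- As `k ≥ 1`, 3K + 2 ≤ 5k and 2K + 1 ≤ 3k, so the cuts take at most 15k²n words; the table and
  -- its header take 1 + n² ≤ 2n². Both fit under the factor 17.
  · have h1 : (3 * K + 2) * n * (2 * K + 1) ≤ (5 * k) * n * (3 * k) := by
      gcongr <;> omega
    have h2 : (5 * k) * n * (3 * k) = 15 * (k ^ 2 * n) := by ring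
    have h3 : n * n = n ^ 2 := by ring
    rw [length_layout]
    omega
  · have h1 : (3 * K + 2) * n ≤ (5 * k) * n := by
      gcongr; omega
    rw [List.length_map, Finset.length_toList]
    linarith
  · intro x hx
    rcases mem_layout hx with rfl | ⟨s, t, rfl⟩ | hx
    · omega
    · exact htab s t
    · have := hbody_mem x hx
      omega
  · intro p hp
    obtain ⟨f, hf, rfl⟩ := List.mem_map.1 hp
    rw [Finset.mem_toList] at hf
    obtain ⟨-, s, t, hsep⟩ := Finset.mem_filter.1 hf
    refine ⟨_, hstored f hf, hcard f hf, s, t, ?_, isCut_cutSet hsep⟩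
    rintro rfl
    exact not_separates_self f s hsep
  · intro s t _ h
    have := hcon s t
    rwa [show tab s t = 0 from if_neg fun h' => h'.2 h] at this
  · intro s t hst h
    have := hcon s t
    rwa [show 1 - tab s t = 0 by simp only [tab, if_pos (And.intro hst h)]; omega] at this
  · intro s t hst
    refine ⟨_, hcut s t, fun h => ?_⟩
    have hsmall : ¬ ((k + 1 : ℕ) : ℕ∞) ≤ kappa G s t := by
      intro h'
      have := h'.trans h
      rw [Nat.cast_le] at this
      omega
    obtain ⟨hf, hsep⟩ := hg s t ⟨hst, hsmall⟩
    rw [show tab s t = 1 + n * n + q (g s t) from if_pos ⟨hst, hsmall⟩]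
    exact ⟨List.mem_map_of_mem (f := fun f => 1 + n * n + q f) (Finset.mem_toList.2 hf),
      _, hstored _ hf, hcard _ hf, isCut_cutSet hsep⟩

theorem valid_of_subsingleton [Subsingleton (Fin n)] (conP cutP : WordRAM.Program) (w T k : ℕ)
    (G : SimpleGraph (Fin n)) : CutData.Valid ⟨[], []⟩ conP cutP w T G k where
  words := by simp
  cuts_stored := by simp
  con_yes := fun s t hst => absurd (Subsingleton.elim s t) hst
  con_no := fun s t hst => absurd (Subsingleton.elim s t) hst
  cut := fun s t hst => absurd (Subsingleton.elim s t) hst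

end DataStructure

end NodeConn

/-- There are fixed query programs `conP`, `cutP` and absolute constants such that every undirected
graph `G` with `n` nodes and every `k ≥ 1` have a data structure of at most `cSpace * (k²n + n²)` words
of `O(log n)` bits, with a list of at most `cList * (k n)` cuts, on which both programs answer
their queries in at most `T` steps. -/
theorem theorem2 :
    ∃ (conP cutP : WordRAM.Program) (cSpace cList cWord T : ℕ),
      ∀ (n k : ℕ), 1 ≤ k → ∀ G : SimpleGraph (Fin n),
        ∃ D : NodeConn.CutData,
          D.mem.length ≤ cSpace * (k ^ 2 * n + n ^ 2) ∧
          D.cuts.length ≤ cList * (k * n) ∧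
          D.Valid conP cutP (cWord * (Nat.log 2 n + 1)) T G k := by
  refine ⟨WordRAM.lookup ++ [.sub 0 5 0], WordRAM.lookup, 17, 5, 8, 7, fun n k hk G => ?_⟩
  rcases Nat.lt_or_ge n 2 with hn | hn
  -- With fewer than two nodes there are no queries, and the empty memory will do.
  · have : Subsingleton (Fin n) := Fin.subsingleton_iff_le_one.2 (by omega)
    exact ⟨⟨[], []⟩, by simp, by simp, NodeConn.valid_of_subsingleton _ _ _ _ _ _⟩
  · exact NodeConn.exists_cutData k hk hn G
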